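/- **Conventions.** For a Noetherian space $X$, the *stature* $\|X\|$ is the ordinal rank of the well-founded poset of proper closed subsets of $X$ ordered by inclusion, i.e. the rank of $X$ in the poset of all closed subsets of $X$, where $\mathrm{rk}(F)=\sup_{F'\subsetneq F}(\mathrm{rk}(F')+1)$. Products written $\times$ are ordinary ordinal products. If $\alpha=\omega^{\alpha_1}+\cdots+\omega^{\alpha_m}$ and $\beta=\omega^{\beta_1}+\cdots+\omega^{\beta_n}$ are in Cantor normal form (non-increasing exponents), the natural sum $\alpha\oplus\beta$ is the sum of all the terms $\omega^{\alpha_i}$ and $\omega^{\beta_j}$ in non-increasing order, and the natural product $\alpha\otimes\beta$ is the natural sum of all the $\omega^{\alpha_i\oplus\beta_j}$. The empty natural product is $1$, and for non-zero ordinals $\alpha_n$, $\bigotimes_{n=1}^{+\infty}\alpha_n$ denotes $\sup_{n\in\mathbb N}\bigotimes_{i=1}^n\alpha_i$. Let $X_1,X_2,\ldots$ be topological spaces. Let $\triangleright_{n=1}^{+\infty}X_n$ be the set of heterogeneous words, i.e. of tuples $w=(x_1,\ldots,x_m)\in X_1\times\cdots\times X_m$ with $m=|w|\in\mathbb N$,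 with the *prefix topology*: its open sets are the empty set and the sets $\{w\mid w\in U_{|w|}\}$, where $(U_n)_{n\in\mathbb N}$ is a sequence of open sets $U_n\subseteq\prod_{i=1}^nX_i$ such that $U_n\times X_{n+1}\subseteq U_{n+1}$ for every $n$, and $U_n=\prod_{i=1}^nX_i$ for some $n$. If all $X_n$ equal $X$, the space is written $X^\triangleright$. **Theorem.** Let $X_1,X_2,\ldots$ be non-empty Noetherian spaces. Then $\triangleright_{n=1}^{+\infty}X_n$ is Noetherian, and: 1. if $\|X_n\|$ is infinite for infinitely many $n$, then $\bigl\|\triangleright_{n=1}^{+\infty}X_n\bigr\|=\bigotimes_{n=1}^{+\infty}\|X_n\|$; 2. if $\|X_n\|$ is finite for all $n$ large enough, then $\bigl\|\triangleright_{n=1}^{+\infty}X_n\bigr\|=\Bigl(\bigotimes_{m=1}^{k}\|X_m\|\Bigr)\times\omega$, where $k$ is the largest index such that $\|X_k\|$ is infinite, or $0$ if there is none. **Homogeneous case.** For every (possibly empty) Noetherian space $X$, the space $X^\triangleright$ is Noetherian, and: 1. if $\|X\|=0$, then $\|X^\triangleright\|=1$; 2. if $\|X\|$ is finite and non-zero,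 then $\|X^\triangleright\|=\omega$; 3. if $\|X\|$ is infinite, then $\|X^\triangleright\|=\omega^{\omega^{\beta_1+1}}$, where $\|X\|=\omega^{\alpha_1}+\cdots+\omega^{\alpha_m}$ and $\alpha_1=\omega^{\beta_1}+\cdots+\omega^{\beta_n}$ in Cantor normal form ($\alpha_1\geq\cdots\geq\alpha_m$, $\beta_1\geq\cdots\geq\beta_n$). -/

import Mathlib

open TopologicalSpace Filter
open scoped Ordinal

universe u

/-! ### Cantor normal forms, natural sum and natural product of ordinals -/

/-- The list `[a₁, …, aₘ]` is the Cantor normal form of `α`: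
`a₁ ≥ ⋯ ≥ aₘ` and `α = ω ^ a₁ + ⋯ + ω ^ aₘ`. -/
def IsCNF (α : Ordinal.{u}) (l : List Ordinal.{u}) : Prop :=
  l.Pairwise (· ≥ ·) ∧ (l.map fun a => ω ^ a).sum = α

/-- The list of exponents of the Cantor normal form of `α`, in decreasing order and with
repetitions: a term `ω ^ e * c` with finite coefficient `c` contributes `c` copies of `e`. -/
noncomputable def cnfExponents (α : Ordinal.{u}) : List Ordinal.{u} :=
  (Ordinal.CNF ω α).flatMap fun p => List.replicate (Cardinal.toNat p.2.card) p.1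

theorem isCNF_cnfExponents (α : Ordinal.{u}) : IsCNF α (cnfExponents α) := by
  constructor
  · rw [cnfExponents, List.pairwise_flatMap]
    refine ⟨fun p _ => ?_, ?_⟩
    · exact List.pairwise_replicate.2 (Or.inr le_rfl)
    · have h := (Ordinal.CNF.sortedGT ω α).pairwise
      rw [List.pairwise_map] at h
      refine h.imp ?_
      intro p q hpq x hx y hy
      rw [List.eq_of_mem_replicate hx, List.eq_of_mem_replicate hy]
      exact hpq.le
  · have key : ∀ l : List (Ordinal.{u} × Ordinal.{u}), (∀ p ∈ l, p.2 < ω) →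
        ((l.flatMap fun p => List.replicate (Cardinal.toNat p.2.card) p.1).map
          fun a => ω ^ a).sum = l.foldr (fun p r => ω ^ p.1 * p.2 + r) 0 := by
      intro l
      induction l with
      | nil => intro _; simp
      | cons p l ih =>
        intro h
        obtain ⟨n, hn⟩ := Ordinal.lt_omega0.1 (h p (by simp))
        rw [List.flatMap_cons, List.map_append, List.sum_append, List.foldr_cons,
          ih fun q hq => h q (by simp [hq]), hn]
        simp
    rw [cnfExponents, key _ fun p hp => Ordinal.CNF.snd_lt Ordinal.one_lt_omega0 hp]
    exact Ordinal.CNF.foldr ω α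

/-- The sum of all `ω ^ a`, `a ∈ s`, in decreasing order of the exponents. -/
noncomputable def sumOmegaPow (s : Multiset Ordinal.{u}) : Ordinal.{u} :=
  ((s.sort (· ≥ ·)).map fun a => ω ^ a).sum

/-- The natural (Hessenberg) sum `α ⊕ β`: the exponents of the two Cantor normal forms are put
together and sorted. -/
noncomputable def natSum (α β : Ordinal.{u}) : Ordinal.{u} :=
  sumOmegaPow ((cnfExponents α : Multiset Ordinal.{u}) + (cnfExponents β : Multiset Ordinal.{u}))

/-- The natural (Hessenberg) product `α ⊗ β`: if `α = ω ^ a₁ + ⋯ + ω ^ aₘ` and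
`β = ω ^ b₁ + ⋯ + ω ^ bₙ` in Cantor normal form, it is the natural sum of all the ordinals
`ω ^ (aᵢ ⊕ bⱼ)`. -/
noncomputable def natProd (α β : Ordinal.{u}) : Ordinal.{u} :=
  sumOmegaPow (((cnfExponents α : Multiset Ordinal.{u}) ×ˢ
    (cnfExponents β : Multiset Ordinal.{u})).map fun p => natSum p.1 p.2)

/-- The finite natural product `f 0 ⊗ ⋯ ⊗ f (n - 1)`, equal to `1` for `n = 0`. -/
noncomputable def finNatProd (f : ℕ → Ordinal.{u}) : ℕ → Ordinal.{u}
  | 0 => 1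
  | n + 1 => natProd (finNatProd f n) (f n)

/-- The infinite natural product `⨂ₙ f n`: the supremum of the finite natural products. -/
noncomputable def infNatProd (f : ℕ → Ordinal.{u}) : Ordinal.{u} :=
  ⨆ n : ℕ, finNatProd f n

/-! ### Stature -/

/-- The stature `‖X‖` of a Noetherian space `X`: the ordinal rank of the poset of proper closed
subsets of `X`, that is, the rank of the largest element `X` in the well-founded poset of all
closed subsets of `X` ordered by inclusion. -/
noncomputable def stature (X : Type u) [TopologicalSpace X] [NoetherianSpace X] : Ordinal.{u} :=
  IsWellFounded.rank (α := Closeds X) (· < ·) ⊤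

/-! ### Heterogeneous words and the prefix topology -/

/-- Heterogeneous words over `X 0, X 1, …`: tuples in `X 0 × ⋯ × X (m - 1)` for some `m`. -/
structure HetWord (X : ℕ → Type u) : Type u where
  /-- the length of the word -/
  length : ℕ
  /-- the tuple of its letters -/
  letters : (i : Fin length) → X i

/-- A telescope: open subsets `U n` of the finite products `X 0 × ⋯ × X (n - 1)` such that
`U n × X n ⊆ U (n + 1)`. -/
structure Telescope (X : ℕ → Type u) [∀ n, TopologicalSpace (X n)] where
  /-- the open set at each length -/
  U : (n : ℕ) → Set ((i : Fin n) → X i)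
  isOpen_U : ∀ n, IsOpen (U n)
  mul_subset : ∀ (n : ℕ) (w : (i : Fin (n + 1)) → X i),
    (fun i : Fin n => w i.castSucc) ∈ U n → w ∈ U (n + 1)

namespace Telescope

variable {X : ℕ → Type u} [∀ n, TopologicalSpace (X n)]

/-- A telescope is wide if `U n` is the whole product for some `n`. -/
def IsWide (T : Telescope X) : Prop := ∃ n, T.U n = Set.univ

/-- The set of words `w` such that `w ∈ U |w|`. -/
def words (T : Telescope X) : Set (HetWord X) := {w | w.letters ∈ T.U w.length}

theorem eq_univ_of_le (T : Telescope X) {m n : ℕ} (hmn : m ≤ n) (h : T.U m = Set.univ) :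
    T.U n = Set.univ := by
  induction n, hmn using Nat.le_induction with
  | base => exact h
  | succ n _ ih =>
    exact Set.eq_univ_of_forall fun w => T.mul_subset n w (ih ▸ Set.mem_univ _)

end Telescope

/-- The prefix topology: the open sets are the empty set and the sets of words of wide
telescopes. -/
instance HetWord.instTopologicalSpace (X : ℕ → Type u) [∀ n, TopologicalSpace (X n)] :
    TopologicalSpace (HetWord X) where
  IsOpen S := S = ∅ ∨ ∃ T : Telescope X, T.IsWide ∧ S = T.words
  isOpen_univ :=
    Or.inr ⟨⟨fun _ => Set.univ, fun _ => isOpen_univ, fun _ _ _ => trivial⟩, ⟨0, rfl⟩, rfl⟩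
  isOpen_inter := by
    rintro S S' (rfl | ⟨T, ⟨m, hm⟩, rfl⟩) (rfl | ⟨T', ⟨m', hm'⟩, rfl⟩)
    · simp
    · simp
    · simp
    · refine Or.inr ⟨⟨fun n => T.U n ∩ T'.U n, fun n => (T.isOpen_U n).inter (T'.isOpen_U n),
        fun n w hw => ⟨T.mul_subset n w hw.1, T'.mul_subset n w hw.2⟩⟩, ⟨max m m', ?_⟩, rfl⟩
      change T.U (max m m') ∩ T'.U (max m m') = Set.univ
      rw [T.eq_univ_of_le (le_max_left _ _) hm, T'.eq_univ_of_le (le_max_right _ _) hm',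
        Set.univ_inter]
  isOpen_sUnion := by
    intro s hs
    by_cases h : ∃ T : Telescope X, T.IsWide ∧ T.words ∈ s
    · obtain ⟨T₀, ⟨m, hm⟩, hT₀⟩ := h
      refine Or.inr ⟨⟨fun n => ⋃ T ∈ {T : Telescope X | T.words ∈ s}, T.U n,
        fun n => isOpen_biUnion fun T _ => T.isOpen_U n, ?_⟩, ⟨m, ?_⟩, ?_⟩
      · intro n w hw
        simp only [Set.mem_iUnion] at hw ⊢
        obtain ⟨T, hT, hw⟩ := hw
        exact ⟨T, hT, T.mul_subset n w hw⟩
      · exact Set.eq_univ_of_forall fun w =>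
          Set.mem_biUnion (show T₀ ∈ {T : Telescope X | T.words ∈ s} from hT₀)
            (hm ▸ Set.mem_univ w)
      · ext w
        simp only [Set.mem_sUnion, Telescope.words, Set.mem_ofPred_eq, Set.mem_iUnion]
        constructor
        · rintro ⟨S, hS, hw⟩
          rcases hs S hS with rfl | ⟨T, _, rfl⟩
          · exact hw.elim
          · exact ⟨T, hS, hw⟩
        · rintro ⟨T, hT, hw⟩
          exact ⟨_, hT, hw⟩
    · refine Or.inl (Set.sUnion_eq_empty.2 fun S hS => ?_)
      rcases hs S hS with rfl | ⟨T, hT, rfl⟩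
      · rfl
      · exact (h ⟨T, hT, hS⟩).elim

/-!
A proper closed set of heterogeneous words contains only words of length less than some `n`, and
the words of length exactly `n` form a copy of the finite product `X 0 × ⋯ × X (n - 1)`. So the
closed set `shortWords X n` of words of length less than `n` is built by stacking these finite
products on top of each other, and its rank lies between the ordinary sum and the natural sum of
their statures (`closedRank_add_stature_le`, `closedRank_le_natSum`). Consequently only leading
exponents matter: if `d n` is the leading exponent of the natural product of the first `n`
statures, the stature of the space of words is the supremum of the `ω ^ (d n + 1)`
(`HetWord.isLUB_stature`). All the formulas follow by computing this supremum: if infinitely many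
factors are infinite, then `d` increases forever and the supremum is that of the finite natural
products themselves; if all factors are finite from `k` on, then `d` is constant from `k` on.

The essential input is that the leading exponent of `‖X × Y‖` is the natural sum of the leading
exponents of `‖X‖` and `‖Y‖` (`log_stature_prod`).
* Upper bound: a proper closed subset of `X × Y` lies in `A × Y ∪ X × B` with `A`, `B` proper
  closed. If `‖X‖ ≤ ω ^ a` and `‖Y‖ ≤ ω ^ b`, then by induction both parts have stature below
  `ω ^ (a ⊕ b)`, which is closed under natural sums. The factor `A` has a stature below a finite
  multiple of some `ω ^ a'` with `a' < a`, and is reduced to pieces of stature at most `ω ^ a'` by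
  splitting off closed subspaces of rank `ω ^ a'`.
* Lower bound: every ordinal below `ω ^ (a ⊕ b)` is below a finite multiple of some
  `ω ^ (a' ⊕ b)` or `ω ^ (a ⊕ b')`, and cutting one factor into finitely many slices, each of
  stature at least `ω ^ a'` or `ω ^ b'`, provides such a multiple by induction.

The facts on natural sums are obtained from the description of Cantor normal forms as multisets of
exponents, on which `⊕` is the addition of multisets.
-/

/-! ### Sums of powers of `ω` and the natural sum -/

theorem sumOmegaPow_zero : sumOmegaPow (0 : Multiset Ordinal.{u}) = 0 := by
  simp [sumOmegaPow]

theorem sumOmegaPow_cons_of_le {m : Ordinal.{u}} {s : Multiset Ordinal.{u}}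
    (h : ∀ x ∈ s, x ≤ m) : sumOmegaPow (m ::ₘ s) = ω ^ m + sumOmegaPow s := by
  unfold sumOmegaPow
  rw [Multiset.sort_cons m s (r := (· ≥ ·)) (fun b hb => h b hb)]
  simp

theorem exists_eq_cons_max {s : Multiset Ordinal.{u}} (hs : s ≠ 0) :
    ∃ m t, s = m ::ₘ t ∧ ∀ x ∈ t, x ≤ m := by
  obtain ⟨m, hm, hmax⟩ := Multiset.exists_max_image id hs
  obtain ⟨t, rfl⟩ := Multiset.exists_cons_of_mem hm
  exact ⟨m, t, rfl, fun x hx => hmax x (Multiset.mem_cons_of_mem hx)⟩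

theorem sumOmegaPow_lt_opow {s : Multiset Ordinal.{u}} {c : Ordinal.{u}}
    (h : ∀ x ∈ s, x < c) : sumOmegaPow s < ω ^ c := by
  induction hn : s.card generalizing s with
  | zero =>
    rw [Multiset.card_eq_zero] at hn
    subst hn
    rw [sumOmegaPow_zero]
    exact Ordinal.opow_pos _ Ordinal.omega0_pos
  | succ n ih =>
    obtain ⟨m, t, rfl, hm⟩ := exists_eq_cons_max (s := s) (by rintro rfl; simp at hn)
    rw [sumOmegaPow_cons_of_le hm]
    refine Ordinal.isPrincipal_add_omega0_opow c ?_ (ih ?_ ?_)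
    · exact (Ordinal.opow_lt_opow_iff_right Ordinal.one_lt_omega0).2 (h m (by simp))
    · exact fun x hx => h x (by simp [hx])
    · simpa using hn

theorem opow_le_sumOmegaPow {s : Multiset Ordinal.{u}} {c : Ordinal.{u}} (h : c ∈ s) :
    ω ^ c ≤ sumOmegaPow s := by
  obtain ⟨m, t, rfl, hm⟩ := exists_eq_cons_max (s := s) (by rintro rfl; simp at h)
  rw [sumOmegaPow_cons_of_le hm]
  have hcm : c ≤ m := by
    rcases Multiset.mem_cons.1 h with rfl | h
    exacts [le_rfl, hm c h]
  exact (Ordinal.opow_le_opow_right Ordinal.omega0_pos hcm).trans le_self_add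

/-- Adding one exponent to both sides is strictly monotone: this is the lexicographic comparison
of Cantor normal forms. -/
theorem sumOmegaPow_cons_lt_cons {s t : Multiset Ordinal.{u}} (c : Ordinal.{u})
    (h : sumOmegaPow s < sumOmegaPow t) : sumOmegaPow (c ::ₘ s) < sumOmegaPow (c ::ₘ t) := by
  induction hn : t.card generalizing s t with
  | zero =>
    rw [Multiset.card_eq_zero] at hn
    subst hn
    rw [sumOmegaPow_zero] at h
    exact absurd h not_lt_zero
  | succ n ih =>
    obtain ⟨m, t, rfl, hm⟩ := exists_eq_cons_max (s := t) (by rintro rfl; simp at hn)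
    have hs : ∀ x ∈ s, x ≤ m := by
      intro x hx
      by_contra! hmx
      refine h.not_ge ((sumOmegaPow_lt_opow (c := x) ?_).le.trans (opow_le_sumOmegaPow hx))
      intro y hy
      rcases Multiset.mem_cons.1 hy with rfl | hy
      exacts [hmx, (hm y hy).trans_lt hmx]
    have hmt : ∀ x ∈ m ::ₘ t, x ≤ m := by
      intro x hx
      rcases Multiset.mem_cons.1 hx with rfl | hx
      exacts [le_rfl, hm x hx]
    rcases le_total m c with hmc | hcm
    · rw [sumOmegaPow_cons_of_le fun x hx => (hs x hx).trans hmc,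
        sumOmegaPow_cons_of_le fun x hx => (hmt x hx).trans hmc]
      exact (add_lt_add_iff_left _).2 h
    · have hct : ∀ x ∈ c ::ₘ t, x ≤ m := by
        intro x hx
        rcases Multiset.mem_cons.1 hx with rfl | hx
        exacts [hcm, hm x hx]
      by_cases hms : m ∈ s
      · obtain ⟨s, rfl⟩ := Multiset.exists_cons_of_mem hms
        have hs' : ∀ x ∈ s, x ≤ m := fun x hx => hs x (by simp [hx])
        have hcs : ∀ x ∈ c ::ₘ s, x ≤ m := by
          intro x hx
          rcases Multiset.mem_cons.1 hx with rfl | hx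
          exacts [hcm, hs' x hx]
        rw [sumOmegaPow_cons_of_le hs', sumOmegaPow_cons_of_le hm, add_lt_add_iff_left] at h
        rw [Multiset.cons_swap, Multiset.cons_swap c m t, sumOmegaPow_cons_of_le hcs,
          sumOmegaPow_cons_of_le hct, add_lt_add_iff_left]
        exact ih h (by simpa using hn)
      · have hs' : ∀ x ∈ s, x < m := fun x hx =>
          (hs x hx).lt_of_ne (by rintro rfl; exact hms hx)
        rw [Multiset.cons_swap c m t, sumOmegaPow_cons_of_le hct]
        rcases hcm.lt_or_eq with hcm | rfl
        · refine (sumOmegaPow_lt_opow ?_).trans_le le_self_add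
          intro x hx
          rcases Multiset.mem_cons.1 hx with rfl | hx
          exacts [hcm, hs' x hx]
        · rw [sumOmegaPow_cons_of_le hs, add_lt_add_iff_left]
          exact (sumOmegaPow_lt_opow hs').trans_le (opow_le_sumOmegaPow (by simp))

theorem sumOmegaPow_add_lt_add {s t : Multiset Ordinal.{u}} (r : Multiset Ordinal.{u})
    (h : sumOmegaPow s < sumOmegaPow t) : sumOmegaPow (s + r) < sumOmegaPow (t + r) := by
  induction r using Multiset.induction_on with
  | empty => simpa using h
  | cons c r ih => simpa using sumOmegaPow_cons_lt_cons c ih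

theorem sumOmegaPow_injective : Function.Injective (sumOmegaPow.{u}) := by
  intro s t h
  induction hn : t.card generalizing s t with
  | zero =>
    rw [Multiset.card_eq_zero] at hn
    subst hn
    by_contra hs
    obtain ⟨m, hm⟩ := Multiset.exists_mem_of_ne_zero hs
    have := opow_le_sumOmegaPow hm
    rw [h, sumOmegaPow_zero] at this
    exact (Ordinal.opow_pos m Ordinal.omega0_pos).not_ge this
  | succ n ih =>
    obtain ⟨m, t, rfl, hm⟩ := exists_eq_cons_max (s := t) (by rintro rfl; simp at hn)
    have hms : m ∈ s := by
      by_contra hms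
      have hs : ∀ x ∈ s, x < m := by
        intro x hx
        by_contra! hmx
        have hmx : m < x := hmx.lt_of_ne (by rintro rfl; exact hms hx)
        refine h.not_gt ((sumOmegaPow_lt_opow (c := x) ?_).trans_le (opow_le_sumOmegaPow hx))
        intro y hy
        rcases Multiset.mem_cons.1 hy with rfl | hy
        exacts [hmx, (hm y hy).trans_lt hmx]
      exact h.not_lt ((sumOmegaPow_lt_opow hs).trans_le (opow_le_sumOmegaPow (by simp)))
    obtain ⟨s, rfl⟩ := Multiset.exists_cons_of_mem hms
    congr 1
    refine ih ?_ (by simpa using hn)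
    by_contra hne
    rcases lt_or_gt_of_ne hne with hlt | hlt
    · exact h.not_lt (sumOmegaPow_cons_lt_cons m hlt)
    · exact h.not_gt (sumOmegaPow_cons_lt_cons m hlt)

theorem sumOmegaPow_cnfExponents (α : Ordinal.{u}) :
    sumOmegaPow (cnfExponents α : Multiset Ordinal.{u}) = α := by
  have h := isCNF_cnfExponents α
  unfold sumOmegaPow
  rw [Multiset.coe_sort, List.mergeSort_of_pairwise]
  · exact h.2
  · simpa using h.1

theorem natSum_sumOmegaPow (s t : Multiset Ordinal.{u}) :
    natSum (sumOmegaPow s) (sumOmegaPow t) = sumOmegaPow (s + t) := by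
  unfold natSum
  rw [sumOmegaPow_injective (sumOmegaPow_cnfExponents (sumOmegaPow s)),
    sumOmegaPow_injective (sumOmegaPow_cnfExponents (sumOmegaPow t))]

theorem natSum_comm (a b : Ordinal.{u}) : natSum a b = natSum b a := by
  unfold natSum
  rw [add_comm]

theorem natSum_zero (a : Ordinal.{u}) : natSum a 0 = a := by
  conv_lhs => rw [← sumOmegaPow_cnfExponents a, ← sumOmegaPow_zero]
  rw [natSum_sumOmegaPow, add_zero, sumOmegaPow_cnfExponents]

theorem zero_natSum (a : Ordinal.{u}) : natSum 0 a = a := by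
  rw [natSum_comm, natSum_zero]

theorem natSum_lt_natSum_right {a b : Ordinal.{u}} (h : a < b) (c : Ordinal.{u}) :
    natSum a c < natSum b c := by
  refine sumOmegaPow_add_lt_add _ ?_
  rwa [sumOmegaPow_cnfExponents, sumOmegaPow_cnfExponents]

theorem natSum_lt_natSum_left {a b : Ordinal.{u}} (c : Ordinal.{u}) (h : a < b) :
    natSum c a < natSum c b := by
  rw [natSum_comm c a, natSum_comm c b]
  exact natSum_lt_natSum_right h c

theorem natSum_le_natSum {a b c d : Ordinal.{u}} (h : a ≤ b) (h' : c ≤ d) :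
    natSum a c ≤ natSum b d :=
  (h.eq_or_lt.elim (fun e => e ▸ le_rfl) fun h => (natSum_lt_natSum_right h c).le).trans
    (h'.eq_or_lt.elim (fun e => e ▸ le_rfl) fun h => (natSum_lt_natSum_left b h).le)

theorem add_le_natSum (a b : Ordinal.{u}) : a + b ≤ natSum a b := by
  induction b using WellFoundedLT.induction with
  | ind b ih =>
    rcases eq_or_ne b 0 with rfl | hb
    · rw [natSum_zero, add_zero]
    · exact (Ordinal.add_le_iff hb).2
        fun d hd => (ih d hd).trans_lt (natSum_lt_natSum_left a hd)

theorem lt_of_mem_cnfExponents {a c e : Ordinal.{u}} (h : a < ω ^ c) (he : e ∈ cnfExponents a) :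
    e < c := by
  by_contra! hce
  refine h.not_ge ?_
  rw [← sumOmegaPow_cnfExponents a]
  exact (Ordinal.opow_le_opow_right Ordinal.omega0_pos hce).trans
    (opow_le_sumOmegaPow (by simpa using he))

/-- Powers of `ω` are closed under natural sums. -/
theorem natSum_lt_opow {a b c : Ordinal.{u}} (ha : a < ω ^ c) (hb : b < ω ^ c) :
    natSum a b < ω ^ c := by
  refine sumOmegaPow_lt_opow fun x hx => ?_
  rcases Multiset.mem_add.1 hx with hx | hx
  · exact lt_of_mem_cnfExponents ha (by simpa using hx)
  · exact lt_of_mem_cnfExponents hb (by simpa using hx)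

theorem sumOmegaPow_replicate_add (a : Ordinal.{u}) (n : ℕ) {s : Multiset Ordinal.{u}}
    (h : ∀ x ∈ s, x ≤ a) :
    sumOmegaPow (Multiset.replicate n a + s) = ω ^ a * n + sumOmegaPow s := by
  induction n with
  | zero => simp
  | succ n ih =>
    rw [Multiset.replicate_succ, Multiset.cons_add, sumOmegaPow_cons_of_le, ih, ← add_assoc]
    · congr 1
      rw [add_comm n 1, Nat.cast_add, mul_add, Nat.cast_one, mul_one]
    · intro x hx
      rcases Multiset.mem_add.1 hx with hx | hx
      · exact (Multiset.eq_of_mem_replicate hx).le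
      · exact h x hx

theorem natSum_opow_mul_natCast (a : Ordinal.{u}) (n : ℕ) {b : Ordinal.{u}} (hb : b < ω ^ a) :
    natSum (ω ^ a * n) b = ω ^ a * n + b := by
  have h := sumOmegaPow_replicate_add a n (s := 0) (by simp)
  rw [sumOmegaPow_zero, add_zero, add_zero] at h
  conv_lhs => rw [← h, ← sumOmegaPow_cnfExponents b]
  rw [natSum_sumOmegaPow, sumOmegaPow_replicate_add, sumOmegaPow_cnfExponents]
  exact fun x hx => (lt_of_mem_cnfExponents hb (by simpa using hx)).le

theorem exists_sumOmegaPow_le_of_lt_add {r s t : Multiset Ordinal.{u}}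
    (h : sumOmegaPow r < sumOmegaPow (s + t)) :
    (∃ s', sumOmegaPow s' < sumOmegaPow s ∧ sumOmegaPow r ≤ sumOmegaPow (s' + t)) ∨
      ∃ t', sumOmegaPow t' < sumOmegaPow t ∧ sumOmegaPow r ≤ sumOmegaPow (s + t') := by
  induction hn : r.card generalizing r s t with
  | zero =>
    rw [Multiset.card_eq_zero] at hn
    subst hn
    rw [sumOmegaPow_zero] at h ⊢
    rcases eq_or_ne s 0 with rfl | hs
    · right
      exact ⟨0, by simpa [sumOmegaPow_zero] using h, zero_le⟩
    · left
      refine ⟨0, ?_, zero_le⟩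
      obtain ⟨m, hm⟩ := Multiset.exists_mem_of_ne_zero hs
      rw [sumOmegaPow_zero]
      exact (Ordinal.opow_pos m Ordinal.omega0_pos).trans_le (opow_le_sumOmegaPow hm)
  | succ n ih =>
    -- By symmetry the largest exponent of `s + t` may be assumed to lie in `s`.
    have key : ∀ {s t : Multiset Ordinal.{u}} {m : Ordinal.{u}},
        sumOmegaPow r < sumOmegaPow (s + t) → m ∈ s → (∀ x ∈ s + t, x ≤ m) →
        (∃ s', sumOmegaPow s' < sumOmegaPow s ∧ sumOmegaPow r ≤ sumOmegaPow (s' + t)) ∨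
          ∃ t', sumOmegaPow t' < sumOmegaPow t ∧ sumOmegaPow r ≤ sumOmegaPow (s + t') := by
      intro s t m h hm hmax
      have hr : ∀ x ∈ r, x ≤ m := by
        intro x hx
        by_contra! hmx
        exact h.not_ge ((sumOmegaPow_lt_opow fun y hy => (hmax y hy).trans_lt hmx).le.trans
          (opow_le_sumOmegaPow hx))
      by_cases hmr : m ∈ r
      · obtain ⟨s, rfl⟩ := Multiset.exists_cons_of_mem hm
        obtain ⟨r, rfl⟩ := Multiset.exists_cons_of_mem hmr
        have h' : sumOmegaPow r < sumOmegaPow (s + t) := by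
          rwa [Multiset.cons_add, sumOmegaPow_cons_of_le, sumOmegaPow_cons_of_le,
            add_lt_add_iff_left] at h
          · exact fun x hx => hmax x (by simp_all)
          · exact fun x hx => hr x (by simp_all)
        have hcons : ∀ {p q : Multiset Ordinal.{u}}, sumOmegaPow p ≤ sumOmegaPow q →
            sumOmegaPow (m ::ₘ p) ≤ sumOmegaPow (m ::ₘ q) := by
          intro p q hpq
          rcases hpq.eq_or_lt with e | hlt
          · rw [sumOmegaPow_injective e]
          · exact (sumOmegaPow_cons_lt_cons m hlt).le
        rcases ih h' (by simpa using hn) with ⟨s', h1, h2⟩ | ⟨t', h1, h2⟩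
        · refine Or.inl ⟨m ::ₘ s', sumOmegaPow_cons_lt_cons m h1, ?_⟩
          rw [Multiset.cons_add]
          exact hcons h2
        · refine Or.inr ⟨t', h1, ?_⟩
          rw [Multiset.cons_add]
          exact hcons h2
      · refine Or.inl ⟨r, (sumOmegaPow_lt_opow fun x hx => (hr x hx).lt_of_ne ?_).trans_le
          (opow_le_sumOmegaPow hm), ?_⟩
        · rintro rfl
          exact hmr hx
        · have := add_le_natSum (sumOmegaPow r) (sumOmegaPow t)
          rw [natSum_sumOmegaPow] at this
          exact le_self_add.trans this
    have hst : s + t ≠ 0 := by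
      intro h0
      rw [h0, sumOmegaPow_zero] at h
      exact not_lt_zero h
    obtain ⟨m, u, hu, hm⟩ := exists_eq_cons_max hst
    have hmax : ∀ x ∈ s + t, x ≤ m := by
      rw [hu]
      intro x hx
      rcases Multiset.mem_cons.1 hx with rfl | hx
      exacts [le_rfl, hm x hx]
    have hmem : m ∈ s + t := hu ▸ Multiset.mem_cons_self m u
    rcases Multiset.mem_add.1 hmem with hms | hmt
    · exact key h hms hmax
    · rw [add_comm] at h hmax
      simpa only [add_comm] using (key h hmt hmax).symm

/-- The natural sum `a ⊕ b` is the least ordinal above all `a' ⊕ b` with `a' < a` and all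
`a ⊕ b'` with `b' < b`. -/
theorem exists_le_natSum_of_lt_natSum {a b c : Ordinal.{u}} (h : c < natSum a b) :
    (∃ a' < a, c ≤ natSum a' b) ∨ ∃ b' < b, c ≤ natSum a b' := by
  rw [← sumOmegaPow_cnfExponents a, ← sumOmegaPow_cnfExponents b, ← sumOmegaPow_cnfExponents c,
    natSum_sumOmegaPow] at h
  rcases exists_sumOmegaPow_le_of_lt_add h with ⟨s, h1, h2⟩ | ⟨t, h1, h2⟩
  · rw [sumOmegaPow_cnfExponents] at h1 h2
    rw [← natSum_sumOmegaPow, sumOmegaPow_cnfExponents] at h2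
    exact Or.inl ⟨_, h1, h2⟩
  · rw [sumOmegaPow_cnfExponents] at h1 h2
    rw [← natSum_sumOmegaPow, sumOmegaPow_cnfExponents] at h2
    exact Or.inr ⟨_, h1, h2⟩

/-! ### Leading exponents -/

theorem log_sumOmegaPow_eq {s : Multiset Ordinal.{u}} {m : Ordinal.{u}} (hm : m ∈ s)
    (hmax : ∀ x ∈ s, x ≤ m) : Ordinal.log ω (sumOmegaPow s) = m := by
  have h1 := opow_le_sumOmegaPow hm
  have h0 : sumOmegaPow s ≠ 0 :=
    ((Ordinal.opow_pos m Ordinal.omega0_pos).trans_le h1).ne'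
  refine (Ordinal.log_eq_iff Ordinal.one_lt_omega0 h0 m).2 ⟨h1, ?_⟩
  exact sumOmegaPow_lt_opow fun x hx => Order.lt_succ_iff.2 (hmax x hx)

theorem log_mem_cnfExponents {a : Ordinal.{u}} (ha : a ≠ 0) :
    Ordinal.log ω a ∈ cnfExponents a ∧ ∀ x ∈ cnfExponents a, x ≤ Ordinal.log ω a := by
  have hne : (cnfExponents a : Multiset Ordinal.{u}) ≠ 0 := by
    intro h
    rw [← sumOmegaPow_cnfExponents a, h, sumOmegaPow_zero] at ha
    exact ha rfl
  obtain ⟨m, t, hmt, hm⟩ := exists_eq_cons_max hne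
  have hmem : m ∈ (cnfExponents a : Multiset Ordinal.{u}) := hmt ▸ Multiset.mem_cons_self m t
  have hmax : ∀ x ∈ (cnfExponents a : Multiset Ordinal.{u}), x ≤ m := by
    rw [hmt]
    intro x hx
    rcases Multiset.mem_cons.1 hx with rfl | hx
    exacts [le_rfl, hm x hx]
  have hlog := log_sumOmegaPow_eq hmem hmax
  rw [sumOmegaPow_cnfExponents] at hlog
  rw [hlog]
  exact ⟨by simpa using hmem, fun x hx => hmax x (by simpa using hx)⟩

theorem natProd_mem {a b : Ordinal.{u}} (ha : a ≠ 0) (hb : b ≠ 0) :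
    natSum (Ordinal.log ω a) (Ordinal.log ω b) ∈
      ((cnfExponents a : Multiset Ordinal.{u}) ×ˢ
        (cnfExponents b : Multiset Ordinal.{u})).map fun p => natSum p.1 p.2 :=
  Multiset.mem_map.2 ⟨(Ordinal.log ω a, Ordinal.log ω b), Multiset.mem_product.2
    ⟨by simpa using (log_mem_cnfExponents ha).1, by simpa using (log_mem_cnfExponents hb).1⟩, rfl⟩

theorem natProd_ne_zero {a b : Ordinal.{u}} (ha : a ≠ 0) (hb : b ≠ 0) : natProd a b ≠ 0 :=
  ((Ordinal.opow_pos _ Ordinal.omega0_pos).trans_le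
    (opow_le_sumOmegaPow (natProd_mem ha hb))).ne'

theorem log_natProd {a b : Ordinal.{u}} (ha : a ≠ 0) (hb : b ≠ 0) :
    Ordinal.log ω (natProd a b) = natSum (Ordinal.log ω a) (Ordinal.log ω b) := by
  refine log_sumOmegaPow_eq (natProd_mem ha hb) fun x hx => ?_
  obtain ⟨p, hp, rfl⟩ := Multiset.mem_map.1 hx
  obtain ⟨h1, h2⟩ := Multiset.mem_product.1 hp
  exact natSum_le_natSum ((log_mem_cnfExponents ha).2 _ (by simpa using h1))
    ((log_mem_cnfExponents hb).2 _ (by simpa using h2))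

theorem IsCNF.log_eq {α a : Ordinal.{u}} {l : List Ordinal.{u}} (h : IsCNF α (a :: l)) :
    Ordinal.log ω α = a := by
  have hα : sumOmegaPow ((a :: l : List Ordinal.{u}) : Multiset Ordinal.{u}) = α := by
    unfold sumOmegaPow
    rw [Multiset.coe_sort, List.mergeSort_of_pairwise]
    · exact h.2
    · simpa using h.1
  rw [← hα]
  refine log_sumOmegaPow_eq (by simp) fun x hx => ?_
  rcases List.mem_cons.1 (by simpa using hx) with rfl | hx
  exacts [le_rfl, (List.pairwise_cons.1 h.1).1 x hx]

/-! ### Ranks of closed sets and statures of subspaces -/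

/-- The rank of a closed set in the poset of all closed sets of a Noetherian space. -/
noncomputable def closedRank {Z : Type u} [TopologicalSpace Z] [NoetherianSpace Z]
    (F : Closeds Z) : Ordinal.{u} :=
  IsWellFounded.rank (α := Closeds Z) (· < ·) F

section Rank

variable {S T Z : Type u} [TopologicalSpace S] [TopologicalSpace T] [TopologicalSpace Z]
  [NoetherianSpace S] [NoetherianSpace T] [NoetherianSpace Z]

theorem closedRank_top : closedRank (⊤ : Closeds Z) = stature Z := rfl

theorem closedRank_strictMono : StrictMono (closedRank (Z := Z)) :=
  WellFoundedLT.rank_strictMono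

theorem closedRank_le_stature (F : Closeds Z) : closedRank F ≤ stature Z :=
  closedRank_strictMono.monotone le_top

theorem closedRank_le_of_forall_lt {F : Closeds Z} {c : Ordinal.{u}}
    (h : ∀ F' < F, closedRank F' < c) : closedRank F ≤ c := by
  unfold closedRank
  rw [IsWellFounded.rank_eq]
  exact Ordinal.iSup_le fun F' => Order.succ_le_of_lt (h F'.1 F'.2)

theorem exists_closedRank_eq {c : Ordinal.{u}} (h : c ≤ stature Z) :
    ∃ F : Closeds Z, closedRank F = c :=
  IsWellFounded.mem_range_rank_of_le h

theorem closedRank_bot : closedRank (⊥ : Closeds Z) = 0 :=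
  le_antisymm (closedRank_le_of_forall_lt fun _ h => absurd h not_lt_bot) zero_le

theorem stature_eq_zero_iff : stature Z = 0 ↔ IsEmpty Z := by
  constructor
  · intro h
    by_contra hne
    rw [not_isEmpty_iff] at hne
    have hlt : closedRank (⊥ : Closeds Z) < closedRank ⊤ := closedRank_strictMono <|
      SetLike.lt_iff_le_and_exists.2 ⟨bot_le, hne.some, trivial, fun h => h⟩
    rw [closedRank_top, h] at hlt
    exact not_lt_zero hlt
  · intro h
    rw [← closedRank_top, ← closedRank_bot (Z := Z)]
    congr 1
    ext x
    exact isEmptyElim x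

theorem stature_ne_zero [Nonempty Z] : stature Z ≠ 0 := fun h =>
  not_isEmpty_of_nonempty Z (stature_eq_zero_iff.1 h)

/-- A closed set covered by a closed set `G` and the continuous image of a space `T` has rank at
most `rk G ⊕ ‖T‖`, since it is determined by its traces on `G` and on `T`. -/
theorem closedRank_le_natSum {g : T → Z} (hg : Continuous g) {F G : Closeds Z}
    (h : (F : Set Z) ⊆ G ∪ Set.range g) :
    closedRank F ≤ natSum (closedRank G) (stature T) := by
  -- A smaller closed set has a strictly smaller trace on `G` or on `T`.
  have key : ∀ F : Closeds Z, (F : Set Z) ⊆ G ∪ Set.range g →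
      closedRank F ≤ natSum (closedRank (F ⊓ G)) (closedRank (F.preimage hg)) := by
    intro F
    induction F using WellFoundedLT.induction with
    | ind F ih =>
      intro hF
      refine closedRank_le_of_forall_lt fun F' hF' => ?_
      refine (ih F' hF' (subset_trans hF'.le hF)).trans_lt ?_
      have h1 : F' ⊓ G ≤ F ⊓ G := inf_le_inf_right G hF'.le
      have h2 : F'.preimage hg ≤ F.preimage hg := fun x hx => hF'.le hx
      rcases h1.lt_or_eq with h1 | h1
      · exact (natSum_lt_natSum_right (closedRank_strictMono h1) _).trans_le
          (natSum_le_natSum le_rfl (closedRank_strictMono.monotone h2))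
      · rw [h1]
        refine natSum_lt_natSum_left _ (closedRank_strictMono (h2.lt_of_ne fun h2 => ?_))
        refine hF'.not_ge fun x hx => ?_
        rcases hF hx with hxG | ⟨t, rfl⟩
        · have : x ∈ F' ⊓ G := h1 ▸ (⟨hx, hxG⟩ : x ∈ F ⊓ G)
          exact this.1
        · have : t ∈ F'.preimage hg := h2 ▸ (show t ∈ F.preimage hg from hx)
          exact this
  exact (key F h).trans (natSum_le_natSum (closedRank_strictMono.monotone inf_le_right)
    (closedRank_le_stature _))

/-- If a subspace `T` lies outside a closed set `F` and inside a closed set `G ⊇ F`, then the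
closed sets of `T` can be stacked on top of `F`. -/
theorem closedRank_add_stature_le {g : T → Z} (hg : Topology.IsInducing g) {F G : Closeds Z}
    (hFG : F ≤ G) (hF : ∀ t, g t ∉ F) (hG : ∀ t, g t ∈ G) :
    closedRank F + stature T ≤ closedRank G := by
  -- As `T` carries the induced topology, `C` is recovered from `F ∪ closure (g '' C)`, so `H` is
  -- strictly monotone.
  let H : Closeds T → Closeds Z := fun C => F ⊔ Closeds.closure (g '' C)
  have hpre : ∀ (C : Closeds T) (t : T), g t ∈ H C ↔ t ∈ C := by
    intro C t
    have hcl : g t ∈ closure (g '' (C : Set T)) ↔ t ∈ C := by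
      have : closure (C : Set T) = g ⁻¹' closure (g '' C) := hg.closure_eq_preimage_closure_image _
      rw [C.isClosed.closure_eq] at this
      exact (Set.ext_iff.1 this t).symm
    exact ⟨fun h => h.elim (fun h => absurd h (hF t)) hcl.1, fun h => Or.inr (hcl.2 h)⟩
  have hmono : StrictMono H := by
    intro C C' hlt
    refine lt_of_le_of_ne (sup_le_sup_left
      (Closeds.gc.monotone_l (Set.image_mono hlt.le)) F) fun h => hlt.not_ge fun t ht => ?_
    exact (hpre C t).1 (h ▸ (hpre C' t).2 ht)
  have hrank : ∀ C : Closeds T, closedRank F + closedRank C ≤ closedRank (H C) := by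
    intro C
    induction C using WellFoundedLT.induction with
    | ind C ih =>
      rcases eq_or_ne (closedRank C) 0 with h0 | h0
      · rw [h0, add_zero]
        exact closedRank_strictMono.monotone le_sup_left
      · refine (Ordinal.add_le_iff h0).2 fun d hd => ?_
        unfold closedRank at hd
        rw [IsWellFounded.rank_eq, Ordinal.lt_iSup_iff] at hd
        obtain ⟨⟨C', hC'⟩, hd⟩ := hd
        exact ((add_le_add_right (Order.lt_succ_iff.1 hd) _).trans (ih C' hC')).trans_lt
          (closedRank_strictMono (hmono hC'))
  refine (hrank ⊤).trans (closedRank_strictMono.monotone (sup_le hFG ?_))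
  refine closure_minimal ?_ G.isClosed
  rintro _ ⟨t, -, rfl⟩
  exact hG t

theorem closedRank_eq_stature {f : S → Z} (hf : Topology.IsInducing f) {F : Closeds Z}
    (hF : (F : Set Z) = Set.range f) : closedRank F = stature S := by
  refine le_antisymm ?_ ?_
  · have := closedRank_le_natSum hf.continuous (F := F) (G := ⊥) (by rw [hF]; simp)
    rwa [closedRank_bot, zero_natSum] at this
  · have := closedRank_add_stature_le hf (F := ⊥) (G := F) bot_le (fun t ht => ht)
      (fun t => by rw [← SetLike.mem_coe, hF]; exact ⟨t, rfl⟩)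
    rwa [closedRank_bot, zero_add] at this

theorem closedRank_eq_stature_coe (F : Closeds Z) :
    closedRank F = stature (F : Set Z) :=
  closedRank_eq_stature Topology.IsInducing.subtypeVal (by simp)

theorem stature_congr (e : S ≃ₜ Z) : stature S = stature Z := by
  rw [← closedRank_top (Z := Z)]
  exact (closedRank_eq_stature e.isInducing (by simp)).symm

theorem stature_add_le {f : S → Z} {g : T → Z} (hf : Topology.IsInducing f)
    (hg : Topology.IsInducing g) (hc : IsClosed (Set.range f))
    (h : Set.range g = (Set.range f)ᶜ) : stature S + stature T ≤ stature Z := by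
  rw [← closedRank_eq_stature hf (F := ⟨_, hc⟩) rfl]
  refine closedRank_add_stature_le hg le_top (fun t ht => ?_) fun _ => trivial
  have : g t ∈ (Set.range f)ᶜ := h ▸ Set.mem_range_self t
  exact this ht

theorem stature_le_natSum {f : S → Z} {g : T → Z} (hf : Topology.IsInducing f)
    (hg : Topology.IsInducing g) (hc : IsClosed (Set.range f))
    (h : Set.range g = (Set.range f)ᶜ) : stature Z ≤ natSum (stature S) (stature T) := by
  rw [← closedRank_eq_stature hf (F := ⟨_, hc⟩) rfl, ← closedRank_top]
  refine closedRank_le_natSum hg.continuous ?_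
  rw [h]
  simp

end Rank

/-! ### Noetherian products -/

section Noetherian

variable {Z : Type*} [TopologicalSpace Z]

theorem noetherianSpace_set_union {s t : Set Z} (hs : NoetherianSpace s) (ht : NoetherianSpace t) :
    NoetherianSpace (s ∪ t : Set Z) := by
  rw [noetherianSpace_set_iff] at *
  intro r hr
  rw [← Set.inter_eq_left.2 hr, Set.inter_union_distrib_left]
  exact (hs _ Set.inter_subset_right).union (ht _ Set.inter_subset_right)

theorem noetherianSpace_set_mono {s t : Set Z} (h : s ⊆ t) (ht : NoetherianSpace t) :
    NoetherianSpace s :=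
  NoetherianSpace.of_subset h

/-- Noetherianity can be checked after removing a neighbourhood of any point. -/
theorem noetherianSpace_set_of_forall_diff {s : Set Z}
    (h : ∀ x ∈ s, ∀ U : Set Z, IsOpen U → x ∈ U → NoetherianSpace (s \ U : Set Z)) :
    NoetherianSpace s := by
  rw [noetherianSpace_set_iff]
  intro t ht
  rcases t.eq_empty_or_nonempty with rfl | ⟨x, hx⟩
  · exact isCompact_empty
  · refine isCompact_iff_finite_subcover.2 fun {ι} U hU hcov => ?_
    obtain ⟨i, hi⟩ := Set.mem_iUnion.1 (hcov hx)
    have hN := (noetherianSpace_set_iff _).1 (h x (ht hx) (U i) (hU i) hi)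
    obtain ⟨J, hJ⟩ := (hN (t \ U i) (Set.sdiff_subset_sdiff_left ht)).elim_finite_subcover U hU
      (Set.sdiff_subset.trans hcov)
    classical
    refine ⟨insert i J, fun y hy => ?_⟩
    by_cases hyi : y ∈ U i
    · exact Set.mem_biUnion (Finset.mem_insert_self i J) hyi
    · obtain ⟨j, hj, hyj⟩ := Set.mem_iUnion₂.1 (hJ ⟨hy, hyi⟩)
      exact Set.mem_biUnion (Finset.mem_insert_of_mem hj) hyj

instance noetherianSpace_prod {X Y : Type*} [TopologicalSpace X] [TopologicalSpace Y]
    [NoetherianSpace X] [NoetherianSpace Y] : NoetherianSpace (X × Y) := by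
  -- Well-founded induction on closed rectangles: removing a neighbourhood of a point leaves a
  -- subset of the union of two smaller rectangles.
  have key : ∀ p : Closeds X × Closeds Y, NoetherianSpace ((p.1 : Set X) ×ˢ (p.2 : Set Y) :) := by
    intro p
    induction p using WellFoundedLT.induction with
    | ind p ih =>
      obtain ⟨A, B⟩ := p
      refine noetherianSpace_set_of_forall_diff ?_
      rintro ⟨x, y⟩ ⟨hx, hy⟩ W hW hxy
      obtain ⟨U, V, hU, hV, hxU, hyV, hUV⟩ := isOpen_prod_iff.1 hW x y hxy
      let A' : Closeds X := A ⊓ ⟨Uᶜ, hU.isClosed_compl⟩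
      let B' : Closeds Y := B ⊓ ⟨Vᶜ, hV.isClosed_compl⟩
      have hA' : A' < A := lt_of_le_of_ne inf_le_left fun h => by
        have : x ∈ A' := h ▸ hx
        exact this.2 hxU
      have hB' : B' < B := lt_of_le_of_ne inf_le_left fun h => by
        have : y ∈ B' := h ▸ hy
        exact this.2 hyV
      refine noetherianSpace_set_mono ?_ (noetherianSpace_set_union
        (ih (A', B) (Prod.mk_lt_mk_of_lt_of_le hA' le_rfl))
        (ih (A, B') (Prod.mk_lt_mk_of_le_of_lt le_rfl hB')))
      rintro ⟨x', y'⟩ ⟨⟨hx', hy'⟩, hW'⟩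
      by_cases hxU' : x' ∈ U
      · exact Or.inr ⟨hx', hy', fun hyV' => hW' (hUV ⟨hxU', hyV'⟩)⟩
      · exact Or.inl ⟨⟨hx', hxU'⟩, hy'⟩
  have h := key ⊤
  rw [Prod.fst_top, Prod.snd_top, Closeds.coe_top, Closeds.coe_top, Set.univ_prod_univ] at h
  exact noetherian_univ_iff.1 h

end Noetherian

/-! ### The leading exponent of the stature of a product -/

section Prod

theorem stature_prod_comm (X Y : Type u) [TopologicalSpace X] [NoetherianSpace X]
    [TopologicalSpace Y] [NoetherianSpace Y] : stature (X × Y) = stature (Y × X) :=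
  stature_congr (Homeomorph.prodComm X Y)

theorem isInducing_prodMap_val {X Y : Type*} [TopologicalSpace X] [TopologicalSpace Y]
    (s : Set X) :
    Topology.IsInducing (Prod.map Subtype.val id : s × Y → X × Y) :=
  Topology.IsInducing.subtypeVal.prodMap Topology.IsInducing.id

theorem range_prodMap_val {X Y : Type*} (s : Set X) :
    Set.range (Prod.map Subtype.val id : s × Y → X × Y) = s ×ˢ Set.univ := by
  rw [Set.range_prodMap, Subtype.range_coe, Set.range_id]

variable {X Y : Type u} [TopologicalSpace X] [NoetherianSpace X]
    [TopologicalSpace Y] [NoetherianSpace Y]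

theorem closedRank_add_stature_compl_le (A : Closeds X) :
    closedRank A + stature ↥(A : Set X)ᶜ ≤ stature X := by
  rw [closedRank_eq_stature_coe]
  exact stature_add_le (f := ((↑) : ↥(A : Set X) → X)) Topology.IsInducing.subtypeVal
    Topology.IsInducing.subtypeVal (by simpa using A.isClosed)
    (by rw [Subtype.range_coe, Subtype.range_coe])

theorem stature_le_natSum_compl (A : Closeds X) :
    stature X ≤ natSum (closedRank A) (stature ↥(A : Set X)ᶜ) := by
  rw [closedRank_eq_stature_coe]
  exact stature_le_natSum (f := ((↑) : ↥(A : Set X) → X)) Topology.IsInducing.subtypeVal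
    Topology.IsInducing.subtypeVal (by simpa using A.isClosed)
    (by rw [Subtype.range_coe, Subtype.range_coe])

theorem stature_prod_add_le (A : Closeds X) :
    stature (↥(A : Set X) × Y) + stature (↥(A : Set X)ᶜ × Y) ≤ stature (X × Y) := by
  refine stature_add_le (isInducing_prodMap_val (A : Set X)) (isInducing_prodMap_val _) ?_ ?_
  · rw [range_prodMap_val]
    exact A.isClosed.prod isClosed_univ
  · rw [range_prodMap_val, range_prodMap_val]
    ext
    simp

theorem stature_prod_le_natSum (A : Closeds X) :
    stature (X × Y) ≤
      natSum (stature (↥(A : Set X) × Y)) (stature (↥(A : Set X)ᶜ × Y)) := by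
  refine stature_le_natSum (isInducing_prodMap_val (A : Set X)) (isInducing_prodMap_val _) ?_ ?_
  · rw [range_prodMap_val]
    exact A.isClosed.prod isClosed_univ
  · rw [range_prodMap_val, range_prodMap_val]
    ext
    simp

end Prod

/-- Splitting off closed subspaces of stature `ω ^ a` one at a time cuts a space of stature below
`ω ^ (a + 1)` into finitely many pieces of stature at most `ω ^ a`. -/
theorem stature_prod_lt_of_lt_succ {Y : Type u} [TopologicalSpace Y] [NoetherianSpace Y]
    {a c : Ordinal.{u}}
    (h : ∀ (X : Type u) [TopologicalSpace X] [NoetherianSpace X],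
      stature X ≤ ω ^ a → stature (X × Y) < ω ^ c)
    (X : Type u) [TopologicalSpace X] [NoetherianSpace X] (hX : stature X < ω ^ Order.succ a) :
    stature (X × Y) < ω ^ c := by
  induction hs : stature X using WellFoundedLT.induction generalizing X with
  | ind x ih =>
    subst hs
    by_cases hle : stature X ≤ ω ^ a
    · exact h X hle
    · obtain ⟨A, hA⟩ := exists_closedRank_eq (not_le.1 hle).le
      have hsplit := closedRank_add_stature_compl_le A
      -- Otherwise `ω ^ a + ‖X‖ ≤ ‖X‖`, which forces `ω ^ (a + 1) ≤ ‖X‖`.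
      have hlt : stature ↥(A : Set X)ᶜ < stature X := by
        by_contra! hge
        have habs : ω ^ a + stature X ≤ stature X := by
          rw [← hA]
          exact (add_le_add_right hge _).trans hsplit
        obtain ⟨n, hn⟩ := Ordinal.lt_omega0_opow_succ.1 hX
        refine hn.not_ge ?_
        clear hn
        induction n with
        | zero => simp
        | succ n ihn =>
          rw [add_comm, Nat.cast_add, mul_add, Nat.cast_one, mul_one]
          exact (add_le_add_right ihn _).trans habs
      refine (stature_prod_le_natSum A).trans_lt (natSum_lt_opow ?_ ?_)
      · exact h _ (by rw [← closedRank_eq_stature_coe, hA])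
      · exact ih _ hlt _ (hlt.trans hX) rfl

theorem stature_prod_lt_of_lt {Y : Type u} [TopologicalSpace Y] [NoetherianSpace Y]
    {a c : Ordinal.{u}}
    (h : ∀ a' < a, ∀ (X : Type u) [TopologicalSpace X] [NoetherianSpace X],
      stature X ≤ ω ^ a' → stature (X × Y) < ω ^ c)
    (X : Type u) [TopologicalSpace X] [NoetherianSpace X] (hX : stature X < ω ^ a) :
    stature (X × Y) < ω ^ c := by
  rcases eq_or_ne (stature X) 0 with h0 | h0
  · have := stature_eq_zero_iff.1 h0
    rw [stature_eq_zero_iff.2 inferInstance]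
    exact Ordinal.opow_pos _ Ordinal.omega0_pos
  · exact stature_prod_lt_of_lt_succ
      (h _ ((Ordinal.lt_opow_iff_log_lt Ordinal.one_lt_omega0 h0).1 hX)) X
      (Ordinal.lt_opow_succ_log_self Ordinal.one_lt_omega0 _)

/-- A proper closed set of `X × Y` misses a rectangle of non-empty open sets, hence lies in
`A × Y ∪ X × B` for proper closed sets `A` and `B`. -/
theorem stature_prod_le_opow (a b : Ordinal.{u}) (X Y : Type u) [TopologicalSpace X]
    [NoetherianSpace X] [TopologicalSpace Y] [NoetherianSpace Y]
    (hX : stature X ≤ ω ^ a) (hY : stature Y ≤ ω ^ b) :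
    stature (X × Y) ≤ ω ^ natSum a b := by
  induction a using WellFoundedLT.induction generalizing b X Y with
  | ind a iha =>
  induction b using WellFoundedLT.induction generalizing X Y with
  | ind b ihb =>
    rw [← closedRank_top]
    refine closedRank_le_of_forall_lt fun C hC => ?_
    obtain ⟨⟨x, y⟩, -, hxy⟩ := SetLike.exists_of_lt hC
    obtain ⟨U, V, hU, hV, hxU, hyV, hUV⟩ :=
      isOpen_prod_iff.1 C.isClosed.isOpen_compl x y hxy
    let A : Closeds X := ⟨Uᶜ, hU.isClosed_compl⟩
    let B : Closeds Y := ⟨Vᶜ, hV.isClosed_compl⟩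
    have hA : A < ⊤ := lt_top_iff_ne_top.2 fun h => by
      have : x ∈ A := h ▸ trivial
      exact this hxU
    have hB : B < ⊤ := lt_top_iff_ne_top.2 fun h => by
      have : y ∈ B := h ▸ trivial
      exact this hyV
    let G : Closeds (X × Y) := ⟨(A : Set X) ×ˢ Set.univ, A.isClosed.prod isClosed_univ⟩
    have hG : closedRank G = stature (↥(A : Set X) × Y) :=
      closedRank_eq_stature (isInducing_prodMap_val _) (range_prodMap_val _).symm
    have hcov : (C : Set (X × Y)) ⊆
        G ∪ Set.range (Prod.map id Subtype.val : X × ↥(B : Set Y) → X × Y) := by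
      rintro ⟨x', y'⟩ hC'
      by_cases hxU' : x' ∈ U
      · exact Or.inr ⟨(x', ⟨y', fun hyV' => hUV ⟨hxU', hyV'⟩ hC'⟩), rfl⟩
      · exact Or.inl ⟨hxU', trivial⟩
    refine (closedRank_le_natSum (continuous_id.prodMap continuous_subtype_val) hcov).trans_lt
      (natSum_lt_opow ?_ ?_)
    · rw [hG]
      refine stature_prod_lt_of_lt (a := a) (fun a' ha' X' _ _ hX' => ?_) _ ?_
      · exact (iha a' ha' b X' Y hX' hY).trans_lt
          ((Ordinal.opow_lt_opow_iff_right Ordinal.one_lt_omega0).2 (natSum_lt_natSum_right ha' b))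
      · rw [← closedRank_eq_stature_coe]
        exact (closedRank_strictMono hA).trans_le hX
    · rw [stature_prod_comm]
      refine stature_prod_lt_of_lt (a := b) (fun b' hb' Y' _ _ hY' => ?_) _ ?_
      · rw [stature_prod_comm]
        exact (ihb b' hb' X Y' hX hY').trans_lt
          ((Ordinal.opow_lt_opow_iff_right Ordinal.one_lt_omega0).2 (natSum_lt_natSum_left a hb'))
      · rw [← closedRank_eq_stature_coe]
        exact (closedRank_strictMono hB).trans_le hY

/-- A closed subspace of rank exactly `ω ^ a * n` leaves a complement of stature at least `ω ^ a`, so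
the bound for single slices adds up along a chain of `n` slices. -/
theorem opow_mul_le_stature_prod {Y : Type u} [TopologicalSpace Y] [NoetherianSpace Y]
    {a c : Ordinal.{u}}
    (h : ∀ (X : Type u) [TopologicalSpace X] [NoetherianSpace X],
      ω ^ a ≤ stature X → ω ^ c ≤ stature (X × Y))
    (n : ℕ) (X : Type u) [TopologicalSpace X] [NoetherianSpace X] (hX : ω ^ a * n ≤ stature X) :
    ω ^ c * n ≤ stature (X × Y) := by
  induction n generalizing X with
  | zero => simp
  | succ n ih =>
    rw [Nat.cast_succ, mul_add, mul_one] at hX ⊢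
    obtain ⟨A, hA⟩ := exists_closedRank_eq (le_self_add.trans hX)
    refine (add_le_add (ih _ ?_) (h _ ?_)).trans (stature_prod_add_le A)
    · rw [← closedRank_eq_stature_coe, hA]
    · by_contra! hlt
      have := hX.trans (stature_le_natSum_compl A)
      rw [hA, natSum_opow_mul_natCast a n hlt] at this
      exact ((add_lt_add_iff_left _).2 hlt).not_ge this

/-- The bound follows by cutting `X` or `Y` into finitely many successive slices, because every
ordinal below `ω ^ (a ⊕ b)` lies below a finite multiple of some `ω ^ (a' ⊕ b)` or
`ω ^ (a ⊕ b')` with `a' < a`, `b' < b`. -/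
theorem opow_le_stature_prod (a b : Ordinal.{u}) (X Y : Type u) [TopologicalSpace X]
    [NoetherianSpace X] [TopologicalSpace Y] [NoetherianSpace Y]
    (hX : ω ^ a ≤ stature X) (hY : ω ^ b ≤ stature Y) :
    ω ^ natSum a b ≤ stature (X × Y) := by
  induction a using WellFoundedLT.induction generalizing b X Y with
  | ind a iha =>
  induction b using WellFoundedLT.induction generalizing X Y with
  | ind b ihb =>
    have hmul : ∀ {d e : Ordinal.{u}} (n : ℕ), d < e → ω ^ d * n ≤ ω ^ e := fun n hde =>
      ((Ordinal.isPrincipal_add_omega0_opow _).mul_natCast_lt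
        ((Ordinal.opow_lt_opow_iff_right Ordinal.one_lt_omega0).2 hde) n).le
    refine le_of_forall_lt fun γ hγ => ?_
    rcases eq_or_ne (natSum a b) 0 with h0 | h0
    · rw [h0, Ordinal.opow_zero, Order.lt_one_iff] at hγ
      subst hγ
      have hXne : Nonempty X := not_isEmpty_iff.1 fun h =>
        ((Ordinal.opow_pos a Ordinal.omega0_pos).trans_le hX).ne' (stature_eq_zero_iff.2 h)
      have hYne : Nonempty Y := not_isEmpty_iff.1 fun h =>
        ((Ordinal.opow_pos b Ordinal.omega0_pos).trans_le hY).ne' (stature_eq_zero_iff.2 h)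
      exact pos_iff_ne_zero.2 stature_ne_zero
    · obtain ⟨c, hc, n, hn⟩ := (Ordinal.lt_omega0_opow h0).1 hγ
      refine hn.trans_le ?_
      rcases exists_le_natSum_of_lt_natSum hc with ⟨a', ha', hca⟩ | ⟨b', hb', hcb⟩
      · refine (mul_le_mul_left (Ordinal.opow_le_opow_right Ordinal.omega0_pos hca) _).trans ?_
        exact opow_mul_le_stature_prod (fun X' _ _ hX' => iha a' ha' b X' Y hX' hY) n X
          ((hmul n ha').trans hX)
      · refine (mul_le_mul_left (Ordinal.opow_le_opow_right Ordinal.omega0_pos hcb) _).trans ?_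
        rw [stature_prod_comm]
        refine opow_mul_le_stature_prod (fun Y' _ _ hY' => ?_) n Y ((hmul n hb').trans hY)
        rw [stature_prod_comm]
        exact ihb b' hb' X Y' hX hY'

theorem log_stature_prod (X Y : Type u) [TopologicalSpace X] [NoetherianSpace X]
    [TopologicalSpace Y] [NoetherianSpace Y] [Nonempty X] [Nonempty Y] :
    Ordinal.log ω (stature (X × Y)) =
      natSum (Ordinal.log ω (stature X)) (Ordinal.log ω (stature Y)) := by
  refine (Ordinal.log_eq_iff Ordinal.one_lt_omega0 stature_ne_zero _).2 ⟨?_, ?_⟩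
  · exact opow_le_stature_prod _ _ X Y (Ordinal.opow_log_le_self _ stature_ne_zero)
      (Ordinal.opow_log_le_self _ stature_ne_zero)
  · refine stature_prod_lt_of_lt_succ (fun X' _ _ hX' => ?_) X
      (Ordinal.lt_opow_succ_log_self Ordinal.one_lt_omega0 _)
    rw [stature_prod_comm]
    refine stature_prod_lt_of_lt_succ (fun Y' _ _ hY' => ?_) Y
      (Ordinal.lt_opow_succ_log_self Ordinal.one_lt_omega0 _)
    rw [stature_prod_comm]
    exact (stature_prod_le_opow _ _ X' Y' hX' hY').trans_lt
      ((Ordinal.opow_lt_opow_iff_right Ordinal.one_lt_omega0).2 (Order.lt_succ _))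

/-! ### Finite products -/

theorem stature_eq_one (X : Type u) [TopologicalSpace X] [NoetherianSpace X] [Unique X] :
    stature X = 1 := by
  refine le_antisymm ?_ (Order.one_le_iff_ne_zero.2 stature_ne_zero)
  rw [← closedRank_top]
  refine closedRank_le_of_forall_lt fun F hF => ?_
  obtain ⟨x, -, hx⟩ := SetLike.exists_of_lt hF
  have : F = ⊥ := by
    ext y
    rw [Subsingleton.elim y x]
    exact ⟨fun h => absurd h hx, fun h => h.elim⟩
  rw [this, closedRank_bot]
  exact zero_lt_one

section Tuples

variable (X : ℕ → Type u) [∀ n, TopologicalSpace (X n)]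

/-- Splitting off the last letter of a tuple. -/
def tupleSnocHomeomorph (n : ℕ) :
    ((i : Fin (n + 1)) → X i) ≃ₜ ((i : Fin n) → X i) × X n where
  toFun w := (fun i => w i.castSucc, w (Fin.last n))
  invFun p := Fin.snoc (α := fun i : Fin (n + 1) => X i) p.1 p.2
  left_inv w := Fin.snoc_init_self w
  right_inv p := by ext <;> simp
  continuous_toFun := by fun_prop
  continuous_invFun := by fun_prop

variable [∀ n, NoetherianSpace (X n)]

instance noetherianSpace_tuples (n : ℕ) : NoetherianSpace ((i : Fin n) → X i) := by
  induction n with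
  | zero => infer_instance
  | succ n ih => exact (noetherianSpace_iff_of_homeomorph (tupleSnocHomeomorph X n)).2 inferInstance

variable [∀ n, Nonempty (X n)]

theorem finNatProd_ne_zero {f : ℕ → Ordinal.{u}} (hf : ∀ n, f n ≠ 0) (n : ℕ) :
    finNatProd f n ≠ 0 := by
  induction n with
  | zero => exact one_ne_zero
  | succ n ih => exact natProd_ne_zero ih (hf n)

theorem log_finNatProd_succ {f : ℕ → Ordinal.{u}} (hf : ∀ n, f n ≠ 0) (n : ℕ) :
    Ordinal.log ω (finNatProd f (n + 1)) =
      natSum (Ordinal.log ω (finNatProd f n)) (Ordinal.log ω (f n)) :=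
  log_natProd (finNatProd_ne_zero hf n) (hf n)

theorem monotone_log_finNatProd {f : ℕ → Ordinal.{u}} (hf : ∀ n, f n ≠ 0) :
    Monotone fun n => Ordinal.log ω (finNatProd f n) :=
  monotone_nat_of_le_succ fun n => by
    rw [log_finNatProd_succ hf]
    exact le_self_add.trans (add_le_natSum _ _)

theorem log_stature_tuples (n : ℕ) :
    Ordinal.log ω (stature ((i : Fin n) → X i)) =
      Ordinal.log ω (finNatProd (fun n => stature (X n)) n) := by
  induction n with
  | zero => rw [stature_eq_one, finNatProd]
  | succ n ih =>
    rw [stature_congr (tupleSnocHomeomorph X n), log_stature_prod, ih,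
      log_finNatProd_succ fun n => stature_ne_zero]

end Tuples

/-! ### Words of bounded length -/

namespace HetWord

variable {X : ℕ → Type u} [∀ n, TopologicalSpace (X n)]

theorem continuous_mk (n : ℕ) :
    Continuous (HetWord.mk n : ((i : Fin n) → X i) → HetWord X) := by
  refine continuous_def.2 ?_
  rintro _ (rfl | ⟨T, -, rfl⟩)
  · exact isOpen_empty
  · exact T.isOpen_U n

/-- An open set `V` of tuples of length `n` is the trace of the open set formed by `V` and all
words of length greater than `n`. -/
theorem isInducing_mk (n : ℕ) :
    Topology.IsInducing (HetWord.mk n : ((i : Fin n) → X i) → HetWord X) := by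
  refine ⟨le_antisymm (continuous_mk n).le_induced ?_⟩
  intro V hV
  have hmem : ∀ w : (i : Fin n) → X i, HetWord.mk n w ∈ HetWord.mk n '' V ↔ w ∈ V := by
    intro w
    constructor
    · rintro ⟨v, hv, h⟩
      injection h with _ h
      exact h ▸ hv
    · exact fun h => ⟨w, h, rfl⟩
  let T : Telescope X :=
    { U := fun j => {w | n < j ∨ HetWord.mk j w ∈ HetWord.mk n '' V}
      isOpen_U := by
        intro j
        rcases lt_trichotomy n j with h | rfl | h
        · simp [h]
        · simp only [lt_irrefl, false_or, hmem]
          exact hV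
        · convert isOpen_empty
          ext w
          refine ⟨?_, fun h => h.elim⟩
          rintro (h' | ⟨v, -, hv⟩)
          · exact absurd h' h.not_gt
          · injection hv with hv _
            exact h.ne' hv
      mul_subset := by
        rintro j w (h | ⟨v, -, hv⟩)
        · exact Or.inl (h.trans j.lt_succ_self)
        · injection hv with hv _
          exact Or.inl (hv ▸ n.lt_succ_self) }
  refine ⟨T.words, Or.inr ⟨T, ⟨n + 1, ?_⟩, rfl⟩, ?_⟩
  · exact Set.eq_univ_of_forall fun w => Or.inl n.lt_succ_self
  · ext w
    change (n < n ∨ HetWord.mk n w ∈ HetWord.mk n '' V) ↔ w ∈ V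
    rw [hmem, or_iff_right (lt_irrefl n)]

/-- The closed set of words of length less than `n`. -/
def shortWords (X : ℕ → Type u) [∀ n, TopologicalSpace (X n)] (n : ℕ) : Closeds (HetWord X) where
  carrier := {w | w.length < n}
  isClosed' := by
    refine ⟨Or.inr ⟨⟨fun j => {_w | n ≤ j}, fun j => isOpen_const,
      fun j _ h => le_trans h j.le_succ⟩, ⟨n, ?_⟩, ?_⟩⟩
    · exact Set.eq_univ_of_forall fun _ => le_refl n
    · ext w
      exact not_lt (a := w.length)

theorem shortWords_zero : shortWords X 0 = ⊥ := by
  ext w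
  exact ⟨fun h => absurd h (Nat.not_lt_zero _), fun h => h.elim⟩

theorem shortWords_mono : Monotone (shortWords X) := fun _ _ hmn _ hw => lt_of_lt_of_le hw hmn

theorem shortWords_succ_subset (n : ℕ) :
    (shortWords X (n + 1) : Set (HetWord X)) ⊆ shortWords X n ∪ Set.range (HetWord.mk n) := by
  rintro ⟨m, w⟩ hw
  rcases (Nat.lt_succ_iff.1 hw).lt_or_eq with h | h
  · exact Or.inl h
  · change m = n at h
    subst h
    exact Or.inr ⟨w, rfl⟩

/-- Non-empty open sets come from wide telescopes, so they contain all sufficiently long words. -/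
theorem exists_subset_shortWords {U : Set (HetWord X)} (hU : IsOpen U) (hne : U.Nonempty) :
    ∃ n, Uᶜ ⊆ (shortWords X n : Set (HetWord X)) := by
  rcases hU with rfl | ⟨T, ⟨n, hn⟩, rfl⟩
  · exact absurd hne Set.not_nonempty_empty
  · refine ⟨n, fun w hw => ?_⟩
    by_contra hlen
    refine hw ?_
    change w.letters ∈ T.U w.length
    rw [T.eq_univ_of_le (not_lt.1 hlen) hn]
    trivial

variable [∀ n, NoetherianSpace (X n)]

theorem noetherianSpace_shortWords (n : ℕ) :
    NoetherianSpace (shortWords X n : Set (HetWord X)) := by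
  induction n with
  | zero =>
    rw [shortWords_zero, noetherianSpace_set_iff]
    rintro t ht
    rw [Set.subset_eq_empty ht rfl]
    exact isCompact_empty
  | succ n ih =>
    exact noetherianSpace_set_mono (shortWords_succ_subset n)
      (noetherianSpace_set_union ih (NoetherianSpace.range _ (continuous_mk n)))

instance noetherianSpace : NoetherianSpace (HetWord X) := by
  refine noetherian_univ_iff.1 (noetherianSpace_set_of_forall_diff fun w _ U hU hw => ?_)
  obtain ⟨n, hn⟩ := exists_subset_shortWords hU ⟨w, hw⟩
  exact noetherianSpace_set_mono (fun v hv => hn hv.2) (noetherianSpace_shortWords n)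

theorem closedRank_shortWords_succ_le (n : ℕ) : closedRank (shortWords X (n + 1)) ≤
    natSum (closedRank (shortWords X n)) (stature ((i : Fin n) → X i)) :=
  closedRank_le_natSum (continuous_mk n) (shortWords_succ_subset n)

theorem closedRank_add_le_shortWords_succ (n : ℕ) :
    closedRank (shortWords X n) + stature ((i : Fin n) → X i) ≤
      closedRank (shortWords X (n + 1)) :=
  closedRank_add_stature_le (isInducing_mk n) (shortWords_mono n.le_succ)
    (fun _ => lt_irrefl n) fun _ => n.lt_succ_self

/-! ### The stature of the space of words -/

variable [∀ n, Nonempty (X n)]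

theorem closedRank_shortWords_lt (n : ℕ) : closedRank (shortWords X n) <
    ω ^ Order.succ (Ordinal.log ω (finNatProd (fun n => stature (X n)) n)) := by
  induction n with
  | zero =>
    rw [shortWords_zero, closedRank_bot]
    exact Ordinal.opow_pos _ Ordinal.omega0_pos
  | succ n ih =>
    have hmono := Ordinal.opow_le_opow_right Ordinal.omega0_pos (Order.succ_le_succ
      (monotone_log_finNatProd (fun n => stature_ne_zero (Z := X n)) n.le_succ))
    refine (closedRank_shortWords_succ_le n).trans_lt
      (natSum_lt_opow (ih.trans_le hmono) (lt_of_lt_of_le ?_ hmono))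
    dsimp only
    rw [← log_stature_tuples]
    exact Ordinal.lt_opow_succ_log_self Ordinal.one_lt_omega0 _

theorem opow_mul_le_closedRank_shortWords (n m : ℕ) :
    ω ^ Ordinal.log ω (finNatProd (fun n => stature (X n)) n) * m ≤
      closedRank (shortWords X (n + m)) := by
  induction m with
  | zero => simp
  | succ m ih =>
    rw [Nat.cast_succ, mul_add, mul_one]
    refine (add_le_add ih ?_).trans (closedRank_add_le_shortWords_succ (n + m))
    refine (Ordinal.opow_le_opow_right Ordinal.omega0_pos (monotone_log_finNatProd
      (fun n => stature_ne_zero (Z := X n)) (Nat.le_add_right n m))).trans ?_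
    dsimp only
    rw [← log_stature_tuples]
    exact Ordinal.opow_log_le_self _ stature_ne_zero

/-- The stature of the space of words only depends on the leading exponents `dₙ` of the finite
natural products: it is the supremum of the ordinals `ω ^ (dₙ + 1)`. -/
theorem isLUB_stature : IsLUB (Set.range fun n =>
    ω ^ Order.succ (Ordinal.log ω (finNatProd (fun n => stature (X n)) n)))
    (stature (HetWord X)) := by
  constructor
  · rintro _ ⟨n, rfl⟩
    refine le_of_forall_lt fun γ hγ => ?_
    obtain ⟨m, hm⟩ := Ordinal.lt_omega0_opow_succ.1 hγ
    exact hm.trans_le ((opow_mul_le_closedRank_shortWords n m).trans (closedRank_le_stature _))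
  · intro c hc
    rw [← closedRank_top]
    refine closedRank_le_of_forall_lt fun F hF => ?_
    obtain ⟨w, -, hw⟩ := SetLike.exists_of_lt hF
    obtain ⟨n, hn⟩ := exists_subset_shortWords F.isClosed.isOpen_compl ⟨w, hw⟩
    rw [compl_compl] at hn
    exact ((closedRank_strictMono.monotone hn).trans_lt (closedRank_shortWords_lt n)).trans_le
      (hc ⟨n, rfl⟩)

theorem stature_eq_infNatProd (h : {n : ℕ | ω ≤ stature (X n)}.Infinite) :
    stature (HetWord X) = infNatProd fun n => stature (X n) := by
  have hne : ∀ n, stature (X n) ≠ 0 := fun n => stature_ne_zero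
  refine le_antisymm (isLUB_stature.2 ?_) (Ordinal.iSup_le fun n => ?_)
  · rintro _ ⟨n, rfl⟩
    -- Some later factor is infinite, and it raises the leading exponent.
    obtain ⟨m, hm, hnm⟩ := h.exists_gt n
    refine le_trans (Ordinal.opow_le_opow_right Ordinal.omega0_pos ?_)
      ((Ordinal.opow_log_le_self ω (finNatProd_ne_zero hne (m + 1))).trans
        (Ordinal.le_iSup (finNatProd fun n => stature (X n)) (m + 1)))
    rw [Order.succ_le_iff, log_finNatProd_succ hne]
    refine (monotone_log_finNatProd hne hnm.le).trans_lt ?_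
    dsimp only
    conv_lhs => rw [← natSum_zero (Ordinal.log ω (finNatProd (fun n => stature (X n)) m))]
    exact natSum_lt_natSum_left _ (Ordinal.log_pos Ordinal.one_lt_omega0 (hne m) hm)
  · exact (Ordinal.lt_opow_succ_log_self Ordinal.one_lt_omega0 _).le.trans
      (isLUB_stature.1 ⟨n, rfl⟩)

theorem stature_eq_finNatProd_mul_omega0 {k : ℕ} (h : ∀ n ≥ k, stature (X n) < ω) :
    stature (HetWord X) = finNatProd (fun n => stature (X n)) k * ω := by
  have hne : ∀ n, stature (X n) ≠ 0 := fun n => stature_ne_zero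
  have hd : ∀ n, Ordinal.log ω (finNatProd (fun n => stature (X n)) n) ≤
      Ordinal.log ω (finNatProd (fun n => stature (X n)) k) := by
    intro n
    rcases le_total n k with hnk | hkn
    · exact monotone_log_finNatProd hne hnk
    · induction n, hkn using Nat.le_induction with
      | base => exact le_rfl
      | succ n hkn ih =>
        rwa [log_finNatProd_succ hne, Ordinal.log_eq_zero (h n hkn), natSum_zero]
  rw [Ordinal.mul_eq_opow_log_succ (finNatProd_ne_zero hne k)
    Ordinal.isPrincipal_mul_omega0 (Ordinal.natCast_lt_omega0 2)]
  refine le_antisymm (isLUB_stature.2 ?_) (isLUB_stature.1 ⟨k, rfl⟩)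
  rintro _ ⟨n, rfl⟩
  exact Ordinal.opow_le_opow_right Ordinal.omega0_pos (Order.succ_le_succ (hd n))

end HetWord

/-- Here the leading exponents of the finite natural products are the `n`-fold natural sums of `a`,
which lie between `ω ^ b * n` and `ω ^ (b + 1)` and are therefore cofinal in the latter. -/
theorem stature_hetWord_const_eq (X : Type u) [TopologicalSpace X] [NoetherianSpace X]
    [Nonempty X] {a b : Ordinal.{u}} (ha : Ordinal.log ω (stature X) = a) (ha0 : a ≠ 0)
    (hb : Ordinal.log ω a = b) : stature (HetWord fun _ => X) = ω ^ ω ^ Order.succ b := by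
  have hne : ∀ _ : ℕ, stature X ≠ 0 := fun _ => stature_ne_zero
  have hlub := HetWord.isLUB_stature (X := fun _ => X)
  have hupper : ∀ n, Ordinal.log ω (finNatProd (fun _ => stature X) n) < ω ^ Order.succ b := by
    intro n
    induction n with
    | zero =>
      rw [finNatProd, Ordinal.log_one_right]
      exact Ordinal.opow_pos _ Ordinal.omega0_pos
    | succ n ih =>
      rw [log_finNatProd_succ hne, ha]
      refine natSum_lt_opow ih ?_
      rw [← hb]
      exact Ordinal.lt_opow_succ_log_self Ordinal.one_lt_omega0 a
  have hlower : ∀ n : ℕ, ω ^ b * n ≤ Ordinal.log ω (finNatProd (fun _ => stature X) n) := by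
    intro n
    induction n with
    | zero => simp
    | succ n ih =>
      rw [log_finNatProd_succ hne, ha, Nat.cast_succ, mul_add, mul_one]
      refine (add_le_add ih ?_).trans (add_le_natSum _ _)
      rw [← hb]
      exact Ordinal.opow_log_le_self _ ha0
  refine le_antisymm (hlub.2 ?_) (le_of_forall_lt fun γ hγ => ?_)
  · rintro _ ⟨n, rfl⟩
    exact Ordinal.opow_le_opow_right Ordinal.omega0_pos (Order.succ_le_of_lt (hupper n))
  · obtain ⟨c, hc, m, hm⟩ :=
      (Ordinal.lt_omega0_opow (Ordinal.opow_pos _ Ordinal.omega0_pos).ne').1 hγ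
    obtain ⟨n, hn⟩ := Ordinal.lt_omega0_opow_succ.1 hc
    refine (Ordinal.lt_omega0_opow_succ.2 ⟨m, hm⟩).trans_le (le_trans ?_ (hlub.1 ⟨n, rfl⟩))
    exact Ordinal.opow_le_opow_right Ordinal.omega0_pos
      (Order.succ_le_succ (hn.le.trans (hlower n)))

theorem mainTheorem5 :
    (∀ (X : ℕ → Type u) [∀ n, TopologicalSpace (X n)] [∀ n, NoetherianSpace (X n)]
        [∀ n, Nonempty (X n)],
      ∃ _ : NoetherianSpace (HetWord X),
        ({n : ℕ | ω ≤ stature (X n)}.Infinite →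
          stature (HetWord X) = infNatProd fun n => stature (X n)) ∧
        ((∀ᶠ n in atTop, stature (X n) < ω) →
          ∃ k : ℕ, IsGreatest (insert 0 {m : ℕ | ∃ j, m = j + 1 ∧ ω ≤ stature (X j)}) k ∧
            stature (HetWord X) = finNatProd (fun n => stature (X n)) k * ω)) ∧
    (∀ (X : Type u) [TopologicalSpace X] [NoetherianSpace X],
      ∃ _ : NoetherianSpace (HetWord fun _ => X),
        (stature X = 0 → stature (HetWord fun _ => X) = 1) ∧
        (stature X ≠ 0 → stature X < ω → stature (HetWord fun _ => X) = ω) ∧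
        (ω ≤ stature X →
          ∀ (a : Ordinal.{u}) (as : List Ordinal.{u}) (b : Ordinal.{u}) (bs : List Ordinal.{u}),
            IsCNF (stature X) (a :: as) → IsCNF a (b :: bs) →
              stature (HetWord fun _ => X) = ω ^ ω ^ (b + 1))) := by
  refine ⟨fun X _ _ _ => ⟨inferInstance, HetWord.stature_eq_infNatProd, fun hfin => ?_⟩,
    fun X _ _ => ⟨inferInstance, fun h0 => ?_, fun h0 hfin => ?_, fun hinf => ?_⟩⟩
  · obtain ⟨N, hN⟩ := eventually_atTop.1 hfin
    set S : Set ℕ := insert 0 {m : ℕ | ∃ j, m = j + 1 ∧ ω ≤ stature (X j)}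
    have hbdd : BddAbove S := by
      refine ⟨N, ?_⟩
      rintro _ (rfl | ⟨j, rfl, hj⟩)
      · exact Nat.zero_le N
      · by_contra! hlt
        exact (hN j (Nat.le_of_lt_succ hlt)).not_ge hj
    have hgreatest : IsGreatest S (sSup S) :=
      ⟨Nat.sSup_mem ⟨0, Set.mem_insert _ _⟩ hbdd, fun _ hm => le_csSup hbdd hm⟩
    refine ⟨sSup S, hgreatest, HetWord.stature_eq_finNatProd_mul_omega0 fun n hn => ?_⟩
    by_contra! hinf
    exact absurd (hgreatest.2 (Or.inr ⟨n, rfl, hinf⟩)) (Nat.not_le_of_lt (Nat.lt_succ_of_le hn))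
  · -- Over an empty alphabet the empty word is the only word.
    have hX := stature_eq_zero_iff.1 h0
    have hw : ∀ w : HetWord fun _ => X, w = ⟨0, fun i => i.elim0⟩ := by
      rintro ⟨n, w⟩
      cases n with
      | zero => congr; exact Subsingleton.elim _ _
      | succ n => exact hX.elim (w 0)
    have : Unique (HetWord fun _ => X) := ⟨⟨⟨0, fun i => i.elim0⟩⟩, hw⟩
    exact stature_eq_one _
  · have hX : Nonempty X := not_isEmpty_iff.1 fun h => h0 (stature_eq_zero_iff.2 h)
    rw [HetWord.stature_eq_finNatProd_mul_omega0 (k := 0) fun _ _ => hfin, finNatProd, one_mul]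
  · intro a as b bs ha hb
    have h0 : stature X ≠ 0 := (Ordinal.omega0_pos.trans_le hinf).ne'
    have hX : Nonempty X := not_isEmpty_iff.1 fun h => h0 (stature_eq_zero_iff.2 h)
    have ha0 : a ≠ 0 := by
      rw [← ha.log_eq]
      exact (Ordinal.log_pos Ordinal.one_lt_omega0 h0 hinf).ne'
    exact stature_hetWord_const_eq X ha.log_eq ha0 hb.log_eq
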